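/- A gauge function is a monotone increasing, right continuous function $g:[0,\infty)\to[0,\infty)$ with $g(0)=0$, and the associated Hausdorff measure on $\mathbb{R}$ is $$\mathcal{H}^g(A)=\lim_{\delta\to 0+}\ \inf\Big\{\sum_{i=1}^\infty g(\operatorname{diam} U_i)\ :\ A\subset\bigcup_{i=1}^\infty U_i,\ \operatorname{diam} U_i<\delta\Big\}.$$ A Borel set $A\subset\mathbb{R}$ is said to be measured by a Hausdorff measure if there is a gauge function $g$ such that $\mathcal{H}^g(A)>0$ and $\mathcal{H}^g$ is $\sigma$-finite on $A$ (that is, $A$ is covered by countably many Borel sets of finite $\mathcal{H}^g$ measure). Every Borel set $B\subset\mathbb{R}$ of the second category (i.e. not meagre) is a union $B=B_1\cup B_2$ of two disjoint Borel sets $B_1,B_2$, each of which is measured by a Hausdorff measure: there are gauge functions $g_1,g_2$ such that, for $i=1,2$, $\mathcal{H}^{g_i}(B_i)>0$ and $\mathcal{H}^{g_i}$ is $\sigma$-finite on $B_i$. -/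

import Mathlib

open MeasureTheory Set
open scoped NNReal ENNReal

/-- A gauge function: a monotone increasing, right continuous `g : [0, ∞) → [0, ∞)`. -/
structure IsGauge (g : ℝ≥0 → ℝ≥0) : Prop where
  mono : Monotone g
  right_cont : ∀ x, ContinuousWithinAt g (Ici x) x

/-- The Hausdorff measure `H^g` on `ℝ` with gauge function `g`, as a measure on the Borel sets:
the limit as `δ → 0+` of the infimum of `∑ g (diam (U i))` over the countable covers by sets of
diameter at most `δ`. The value of the integrand at infinite diameter plays no role, since the
measure is the supremum over all `δ > 0`. -/
noncomputable def gaugeHausdorff (g : ℝ≥0 → ℝ≥0) : Measure ℝ :=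
  Measure.mkMetric fun d : ℝ≥0∞ => (g d.toNNReal : ℝ≥0∞)

/-- For `g 0 = 0`, `gaugeHausdorff g` is given by the textbook formula. -/
theorem gaugeHausdorff_apply (g : ℝ≥0 → ℝ≥0) (h0 : g 0 = 0) (A : Set ℝ) :
    gaugeHausdorff g A =
      ⨆ (δ : ℝ≥0∞) (_ : 0 < δ), ⨅ (U : ℕ → Set ℝ) (_ : A ⊆ ⋃ i, U i)
        (_ : ∀ i, Metric.ediam (U i) ≤ δ), ∑' i, (g (Metric.ediam (U i)).toNNReal : ℝ≥0∞) := by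
  have key : ∀ t : Set ℝ, (⨆ _ : t.Nonempty, (g (Metric.ediam t).toNNReal : ℝ≥0∞)) =
      (g (Metric.ediam t).toNNReal : ℝ≥0∞) := by
    intro t
    rcases t.eq_empty_or_nonempty with rfl | h
    · simp [h0]
    · simp [h]
  rw [gaugeHausdorff, Measure.mkMetric_apply]
  simp only [key]

/-- `A` is measured by a Hausdorff measure: for some gauge function `g`, the set `A` has positive
and σ-finite `H^g`-measure. The clause `g 0 = 0` discards the degenerate gauges, for which every
infinite sum `∑ g (diam (U i))` diverges, so that no set has finite measure in the textbook
formula. -/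
def MeasuredByHausdorff (A : Set ℝ) : Prop :=
  ∃ g : ℝ≥0 → ℝ≥0, IsGauge g ∧ g 0 = 0 ∧ 0 < gaugeHausdorff g A ∧
    SigmaFinite ((gaugeHausdorff g).restrict A)

/-!
If `B` has positive Lebesgue measure, cut it at a point into two parts of positive measure; the
gauge `x ↦ x` serves for both. Otherwise `B` is null, so each of its points lies in infinitely many
of the sets of a sequence `I k` with summable diameters. Being of the second category, `B` contains
the part in some interval of a dense `Gδ` set, and therefore many Cantor sets. Replacing each
interval of a stage of a Cantor set by a large number of tiny ones, spread out evenly, makes its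
natural gauge linear on a range of scales that reaches as far down as one likes. Two disjoint Cantor
sets are refined in turn, so that their linear ranges share out all but finitely many of the indices
`k`. Each range starts only where the remaining diameters have a small sum, compared with the slope
of the gauge, so that for either Cantor set the gauge is summable over the `k` assigned to it. By
the Borel–Cantelli lemma `B` is then the union of two sets that are null for the one and for the
other gauge, and adding the corresponding Cantor set to each makes its measure positive and finite.
-/

open Filter Topology
open scoped Finset

theorem IsGauge.exists_pos_apply_add_lt {g : ℝ≥0 → ℝ≥0} (hg : IsGauge g) (x : ℝ≥0) {ε : ℝ≥0}
    (hε : 0 < ε) : ∃ δ > 0, g (x + δ) < g x + ε := by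
  have hshift : Tendsto (x + ·) (𝓝[>] 0) (𝓝[≥] x) := by
    refine tendsto_nhdsWithin_iff.2 ⟨?_, Eventually.of_forall fun δ => mem_Ici.2 le_self_add⟩
    exact ((continuous_const_add x).tendsto' 0 x (add_zero x)).mono_left nhdsWithin_le_nhds
  have hlt := hshift.eventually
    ((hg.right_cont x).eventually_lt_const (lt_add_of_pos_right (g x) hε))
  exact (eventually_mem_nhdsWithin.and hlt).exists

theorem isGauge_id : IsGauge id := ⟨monotone_id, fun _ => continuousWithinAt_id⟩

theorem gaugeHausdorff_id : gaugeHausdorff id = volume := by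
  have hid : (fun d : ℝ≥0∞ => ((id d.toNNReal : ℝ≥0) : ℝ≥0∞)) =ᶠ[𝓝 0] fun d => d ^ (1 : ℝ) := by
    filter_upwards [gt_mem_nhds ENNReal.zero_lt_top] with d hd
    simp [ENNReal.coe_toNNReal hd.ne]
  rw [← hausdorffMeasure_real]
  exact le_antisymm (Measure.mkMetric_mono hid.le) (Measure.mkMetric_mono hid.symm.le)

theorem measuredByHausdorff_of_volume_pos {A : Set ℝ} (hA : 0 < volume A) :
    MeasuredByHausdorff A :=
  ⟨id, isGauge_id, rfl, by rwa [gaugeHausdorff_id], by rw [gaugeHausdorff_id]; infer_instance⟩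

theorem le_gaugeHausdorff_of_isCompact {g : ℝ≥0 → ℝ≥0} (hg : IsGauge g) (h0 : g 0 = 0)
    {K : Set ℝ} (hK : IsCompact K) {c : ℝ≥0∞}
    (hc : ∀ (V : ℕ → Set ℝ) (d : ℕ → ℝ≥0) (t : Finset ℕ), (∀ i, IsOpen (V i)) →
      (∀ i, Metric.ediam (V i) ≤ d i) → (∀ i, 0 < d i) → K ⊆ ⋃ i ∈ t, V i →
      c ≤ ∑ i ∈ t, (g (d i) : ℝ≥0∞)) :
    c ≤ gaugeHausdorff g K := by
  rw [gaugeHausdorff_apply g h0]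
  refine le_iSup₂_of_le 1 one_pos (le_iInf₂ fun W hKW => le_iInf fun hW => ?_)
  refine ENNReal.le_of_forall_pos_le_add fun ε hε _ => ?_
  obtain ⟨ε', hε', hsum⟩ := ENNReal.exists_pos_sum_of_countable (ENNReal.coe_pos.2 hε).ne' ℕ
  set D : ℕ → ℝ≥0 := fun i => (Metric.ediam (W i)).toNNReal
  choose δ hδ hgδ using fun i => hg.exists_pos_apply_add_lt (D i) (hε' i)
  have hdiam i : Metric.ediam (Metric.thickening (δ i / 2 : ℝ≥0) (W i)) ≤ (D i + δ i : ℝ≥0) := by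
    have hfin : Metric.ediam (W i) ≠ ∞ := ((hW i).trans_lt ENNReal.one_lt_top).ne
    refine (Metric.ediam_thickening_le (δ i / 2)).trans_eq ?_
    rw [ENNReal.coe_add, ENNReal.coe_toNNReal hfin, ← ENNReal.coe_ofNat, ← ENNReal.coe_mul,
      mul_div_cancel₀ _ two_ne_zero]
  obtain ⟨t, ht⟩ := hK.elim_finite_subcover (fun i => Metric.thickening (δ i / 2 : ℝ≥0) (W i))
    (fun i => Metric.isOpen_thickening)
    (hKW.trans (iUnion_mono fun i => Metric.self_subset_thickening (half_pos (hδ i)) _))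
  calc c ≤ ∑ i ∈ t, (g (D i + δ i) : ℝ≥0∞) :=
        hc _ _ t (fun i => Metric.isOpen_thickening) hdiam
          (fun i => add_pos_of_nonneg_of_pos zero_le (hδ i)) ht
    _ ≤ ∑ i ∈ t, ((g (D i) : ℝ≥0∞) + ε' i) :=
        Finset.sum_le_sum fun i _ => mod_cast (hgδ i).le
    _ ≤ ∑' i, ((g (D i) : ℝ≥0∞) + ε' i) := ENNReal.sum_le_tsum t
    _ ≤ (∑' i, (g (D i) : ℝ≥0∞)) + ε := by rw [ENNReal.tsum_add]; gcongr

theorem gaugeHausdorff_frequently_eq_zero {ι : Type*} [Countable ι] {g : ℝ≥0 → ℝ≥0}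
    (hg : Monotone g) {I : ι → Set ℝ} {ℓ : ι → ℝ≥0} (hI : ∀ i, Metric.ediam (I i) ≤ ℓ i)
    (hℓ : ∑' i, (ℓ i : ℝ≥0∞) ≠ ∞) (hgℓ : ∑' i, (g (ℓ i) : ℝ≥0∞) ≠ ∞) :
    gaugeHausdorff g {x | ∃ᶠ i in cofinite, x ∈ I i} = 0 := by
  refine le_antisymm ?_ zero_le
  calc gaugeHausdorff g {x | ∃ᶠ i in cofinite, x ∈ I i}
      ≤ liminf (fun s : Finset ι => ∑' i : {i // i ∉ s},
          (g (Metric.ediam (I i)).toNNReal : ℝ≥0∞)) atTop := by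
        refine Measure.mkMetric_le_liminf_tsum (ι := fun s : Finset ι => {i // i ∉ s}) _ _
          (ENNReal.tendsto_tsum_compl_atTop_zero hℓ) (fun s i => I i)
          (Eventually.of_forall fun s i => ?_) (Eventually.of_forall fun s x hx => ?_) _
        · exact (hI i).trans (ENNReal.le_tsum (f := fun i : {i // i ∉ s} => (ℓ i : ℝ≥0∞)) i)
        · obtain ⟨i, hxi, his⟩ := (hx.and_eventually s.eventually_cofinite_notMem).exists
          exact mem_iUnion.2 ⟨⟨i, his⟩, hxi⟩
    _ ≤ liminf (fun s : Finset ι => ∑' i : {i // i ∉ s}, (g (ℓ i) : ℝ≥0∞)) atTop := by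
        refine liminf_le_liminf (Eventually.of_forall fun s => ENNReal.tsum_le_tsum fun i => ?_)
        exact ENNReal.coe_le_coe.2 (hg (ENNReal.toNNReal_mono ENNReal.coe_ne_top (hI i)))
    _ = 0 := (ENNReal.tendsto_tsum_compl_atTop_zero hgℓ).liminf_eq

theorem exists_frequently_mem_of_gaugeHausdorff_eq_zero {g : ℝ≥0 → ℝ≥0} (h0 : g 0 = 0)
    {A : Set ℝ} (hA : gaugeHausdorff g A = 0) :
    ∃ I : ℕ → Set ℝ, (∀ k, Metric.ediam (I k) ≠ ∞) ∧
      ∑' k, (g (Metric.ediam (I k)).toNNReal : ℝ≥0∞) ≠ ∞ ∧ ∀ x ∈ A, ∃ᶠ k in atTop, x ∈ I k := by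
  obtain ⟨ε, hε, hsum⟩ := ENNReal.exists_pos_sum_of_countable one_ne_zero ℕ
  have hcov j : ∃ W : ℕ → Set ℝ, A ⊆ ⋃ i, W i ∧ (∀ i, Metric.ediam (W i) ≤ 1) ∧
      ∑' i, (g (Metric.ediam (W i)).toNNReal : ℝ≥0∞) < ε j := by
    rw [gaugeHausdorff_apply g h0] at hA
    simp only [ENNReal.iSup_eq_zero] at hA
    simpa only [iInf_lt_iff, exists_prop] using (hA 1 one_pos).trans_lt (ENNReal.coe_pos.2 (hε j))
  choose W hAW hW hWε using hcov
  refine ⟨fun k => W k.unpair.1 k.unpair.2, fun k => ((hW _ _).trans_lt ENNReal.one_lt_top).ne,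
    ne_top_of_lt (b := 1) ?_, fun x hx => frequently_atTop.2 fun n => ?_⟩
  · calc ∑' k : ℕ, (g (Metric.ediam (W k.unpair.1 k.unpair.2)).toNNReal : ℝ≥0∞)
        = ∑' p : ℕ × ℕ, (g (Metric.ediam (W p.1 p.2)).toNNReal : ℝ≥0∞) :=
          Nat.pairEquiv.symm.tsum_eq fun p : ℕ × ℕ =>
            (g (Metric.ediam (W p.1 p.2)).toNNReal : ℝ≥0∞)
      _ = ∑' j, ∑' i, (g (Metric.ediam (W j i)).toNNReal : ℝ≥0∞) :=
          ENNReal.tsum_prod (f := fun j i => (g (Metric.ediam (W j i)).toNNReal : ℝ≥0∞))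
      _ ≤ ∑' j, (ε j : ℝ≥0∞) := ENNReal.tsum_le_tsum fun j => (hWε j).le
      _ < 1 := hsum
  · obtain ⟨i, hi⟩ := mem_iUnion.1 (hAW n hx)
    exact ⟨Nat.pair n i, Nat.left_le_pair n i, by simpa using hi⟩

theorem exists_frequently_mem_of_volume_eq_zero {A : Set ℝ} (hA : volume A = 0) :
    ∃ (I : ℕ → Set ℝ) (ℓ : ℕ → ℝ≥0), (∀ k, Metric.ediam (I k) ≤ ℓ k) ∧ (∀ k, 0 < ℓ k) ∧
      ∑' k, (ℓ k : ℝ≥0∞) ≠ ∞ ∧ ∀ x ∈ A, ∃ᶠ k in atTop, x ∈ I k := by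
  rw [← gaugeHausdorff_id] at hA
  obtain ⟨I, hfin, hI, hAI⟩ := exists_frequently_mem_of_gaugeHausdorff_eq_zero rfl hA
  obtain ⟨ε, hε, hsum⟩ := ENNReal.exists_pos_sum_of_countable one_ne_zero ℕ
  refine ⟨I, fun k => (Metric.ediam (I k)).toNNReal + ε k, fun k => ?_,
    fun k => add_pos_of_nonneg_of_pos zero_le (hε k), ?_, hAI⟩
  · rw [ENNReal.coe_add, ENNReal.coe_toNNReal (hfin k)]
    exact le_self_add
  · simp only [ENNReal.coe_add, ENNReal.tsum_add]
    exact ENNReal.add_ne_top.2 ⟨hI, ne_top_of_lt hsum⟩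

theorem card_mul_le_of_pairwise_le_dist {T : Finset ℝ} {σ L : ℝ} (hL : 0 ≤ L + σ)
    (hsep : (T : Set ℝ).Pairwise fun x y => σ ≤ dist x y)
    (hdist : ∀ x ∈ T, ∀ y ∈ T, dist x y ≤ L) : #T * σ ≤ L + σ := by
  induction T using Finset.induction_on_max generalizing L with
  | empty => simpa using hL
  | insert a s hlt ih =>
    have ha : a ∈ insert a s := Finset.mem_insert_self a s
    have hs {x : ℝ} (hx : x ∈ s) : x ∈ insert a s := Finset.mem_insert_of_mem hx
    have hL₀ : 0 ≤ L := by simpa using hdist a ha a ha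
    -- `a` lies to the right of `s` and at distance at least `σ` from it.
    have hs_dist : ∀ x ∈ s, ∀ y ∈ s, dist x y ≤ L - σ := by
      have hsub : ∀ x ∈ s, ∀ y ∈ s, x - y ≤ L - σ := by
        intro x hx y hy
        have hax : σ ≤ dist a x := hsep ha (hs hx) (hlt x hx).ne'
        have hay := hdist a ha y (hs hy)
        rw [Real.dist_eq, abs_of_pos (sub_pos.2 (hlt _ ‹_›))] at hax hay
        linarith
      exact fun x hx y hy => abs_sub_le_iff.2 ⟨hsub x hx y hy, hsub y hy x hx⟩
    have hcard := ih (by simpa using hL₀) (hsep.mono fun _ => hs) hs_dist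
    rw [Finset.card_insert_of_notMem fun h => (hlt a h).false]
    push_cast
    linarith

theorem exists_separated_finset_of_dense {U : Set ℝ} (hU : Dense U) (x : ℝ) {L : ℝ}
    (hL : 0 < L) {N : ℕ} (hN : 0 < N) :
    ∃ T : Finset ℝ, #T = N ∧ ↑T ⊆ U ∩ Icc x (x + L - L / (2 * N)) ∧
      (T : Set ℝ).Pairwise fun y z => L / (2 * N) ≤ dist y z := by
  have : (0 : ℝ) < N := Nat.cast_pos.2 hN
  set w := L / (2 * N) with hw
  have hw_pos : 0 < w := by positivity
  have hwL : 2 * N * w = L := by rw [hw]; field_simp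
  have hpoint (i : ℕ) : ∃ y ∈ U, x + 2 * i * w < y ∧ y < x + (2 * i + 1) * w :=
    hU.exists_mem_open isOpen_Ioo (nonempty_Ioo.2 (by linarith))
  choose y hyU hy hy' using hpoint
  have hgap {i j : ℕ} (hij : i < j) : y i + w ≤ y j := by
    have hijw : ((i : ℝ) + 1) * w ≤ j * w := by gcongr; exact_mod_cast hij
    linarith [hy' i, hy j]
  have hsep {i j : ℕ} (hij : i ≠ j) : w ≤ dist (y i) (y j) := by
    rcases hij.lt_or_gt with h | h
    · exact (le_sub_iff_add_le'.2 (hgap h)).trans (dist_comm (y i) _ ▸ le_abs_self _)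
    · exact (le_sub_iff_add_le'.2 (hgap h)).trans (le_abs_self _)
  have hinj : Function.Injective y := by
    intro i j hij
    by_contra hne
    exact hw_pos.not_ge (by simpa [hij] using hsep hne)
  refine ⟨(Finset.range N).image y, by simp [Finset.card_image_of_injective _ hinj], ?_, ?_⟩
  · intro z hz
    obtain ⟨i, hi, rfl⟩ := Finset.mem_image.1 hz
    have hiw : ((i : ℝ) + 1) * w ≤ N * w := by gcongr; exact_mod_cast Finset.mem_range.1 hi
    have hiw_nonneg : 0 ≤ i * w := by positivity
    exact ⟨hyU i, by linarith [hy i], by linarith [hy' i]⟩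
  · intro z hz z' hz' hne
    obtain ⟨i, -, rfl⟩ := Finset.mem_image.1 hz
    obtain ⟨j, -, rfl⟩ := Finset.mem_image.1 hz'
    exact hsep fun hij => hne (congrArg y hij)

/-- A finite nonempty family of closed intervals of the same positive length, whose gaps are at
least as long as the intervals: a stage of the construction of a Cantor set. It is encoded by the
left end points of its intervals. -/
structure IntervalFamily where
  left : Finset ℝ
  len : ℝ≥0
  left_nonempty : left.Nonempty
  len_pos : 0 < len
  separated : (left : Set ℝ).Pairwise fun x y => 2 * (len : ℝ) ≤ dist x y

namespace IntervalFamily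

/-- The interval of the family with left end point `x`. -/
def interval (Z : IntervalFamily) (x : ℝ) : Set ℝ := Icc x (x + Z.len)

/-- The union of the intervals of the family. -/
def carrier (Z : IntervalFamily) : Set ℝ := ⋃ x ∈ Z.left, Z.interval x

open Classical in
/-- The left end points of the intervals of the family that meet `V`. -/
noncomputable def meeting (Z : IntervalFamily) (V : Set ℝ) : Finset ℝ :=
  {x ∈ Z.left | (Z.interval x ∩ V).Nonempty}

/-- The mass of `V` that is seen by the family if each of its intervals carries the same mass. -/
noncomputable def proportion (Z : IntervalFamily) (V : Set ℝ) : ℝ≥0 := #(Z.meeting V) / #Z.left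

/-- The density of the uniform probability distribution on the carrier. -/
noncomputable def density (Z : IntervalFamily) : ℝ≥0 := (#Z.left * Z.len)⁻¹

open Classical in
/-- The left end points of the intervals of `Z'` inside the interval of `Z` with left end point
`x`. -/
noncomputable def children (Z Z' : IntervalFamily) (x : ℝ) : Finset ℝ :=
  {y ∈ Z'.left | Z'.interval y ⊆ Z.interval x}

variable {Z Z' : IntervalFamily} {N : ℕ} {V : Set ℝ} {d : ℝ≥0} {x y : ℝ}

theorem mem_meeting : x ∈ Z.meeting V ↔ x ∈ Z.left ∧ (Z.interval x ∩ V).Nonempty := by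
  simp [meeting]

theorem mem_children : y ∈ Z.children Z' x ↔ y ∈ Z'.left ∧ Z'.interval y ⊆ Z.interval x := by
  simp [children]

theorem card_left_pos (Z : IntervalFamily) : (0 : ℝ≥0) < #Z.left :=
  Nat.cast_pos.2 Z.left_nonempty.card_pos

theorem left_mem_interval (Z : IntervalFamily) (x : ℝ) : x ∈ Z.interval x :=
  left_mem_Icc.2 (le_add_of_nonneg_right Z.len.coe_nonneg)

theorem ediam_interval (Z : IntervalFamily) (x : ℝ) : Metric.ediam (Z.interval x) = Z.len := by
  simp [interval]

theorem interval_subset_carrier (hx : x ∈ Z.left) : Z.interval x ⊆ Z.carrier :=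
  subset_biUnion_of_mem (u := Z.interval) hx

theorem isCompact_carrier (Z : IntervalFamily) : IsCompact Z.carrier :=
  Z.left.isCompact_biUnion fun _ _ => isCompact_Icc

theorem pairwiseDisjoint_interval (Z : IntervalFamily) :
    (Z.left : Set ℝ).PairwiseDisjoint Z.interval := by
  intro x hx y hy hxy
  refine Set.disjoint_left.2 fun z hzx hzy => ?_
  have hlen : (0 : ℝ) < Z.len := Z.len_pos
  have hxz : dist x y ≤ Z.len :=
    abs_sub_le_iff.2 ⟨by linarith [hzx.1, hzy.2], by linarith [hzx.2, hzy.1]⟩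
  linarith [Z.separated hx hy hxy]

theorem one_le_sum_proportion {ι : Type*} {t : Finset ι} {V : ι → Set ℝ}
    (h : Z.carrier ⊆ ⋃ i ∈ t, V i) : 1 ≤ ∑ i ∈ t, Z.proportion (V i) := by
  have hcov : Z.left ⊆ t.biUnion fun i => Z.meeting (V i) := by
    intro x hx
    obtain ⟨i, hi, hxi⟩ := mem_iUnion₂.1 (h (interval_subset_carrier hx (Z.left_mem_interval x)))
    exact Finset.mem_biUnion.2 ⟨i, hi, mem_meeting.2 ⟨hx, x, Z.left_mem_interval x, hxi⟩⟩
  simp only [proportion, ← Finset.sum_div]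
  rw [one_le_div Z.card_left_pos]
  exact_mod_cast (Finset.card_le_card hcov).trans Finset.card_biUnion_le

theorem card_meeting_mul_le {σ : ℝ≥0} (hV : Metric.ediam V ≤ d)
    (hsep : (Z.left : Set ℝ).Pairwise fun x y => (σ : ℝ) ≤ dist x y) :
    #(Z.meeting V) * σ ≤ d + Z.len + σ := by
  have hdist : ∀ x ∈ Z.meeting V, ∀ y ∈ Z.meeting V, dist x y ≤ (d + Z.len : ℝ≥0) := by
    intro x hx y hy
    obtain ⟨-, u, hu, huV⟩ := mem_meeting.1 hx
    obtain ⟨-, v, hv, hvV⟩ := mem_meeting.1 hy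
    have huv : dist u v ≤ d :=
      edist_le_coe.1 ((Metric.edist_le_ediam_of_mem huV hvV).trans hV)
    rw [Real.dist_eq, abs_sub_le_iff] at huv ⊢
    push_cast
    constructor <;> linarith [hu.1, hu.2, hv.1, hv.2]
  exact_mod_cast card_mul_le_of_pairwise_le_dist (by positivity)
    (hsep.mono fun x hx => (mem_meeting.1 hx).1) hdist

theorem proportion_le_density_mul (hd : Z.len ≤ d) (hV : Metric.ediam V ≤ d) :
    Z.proportion V ≤ 2 * (Z.density * d) := by
  have hlen := Z.len_pos
  have hcard : #(Z.meeting V) * Z.len ≤ 2 * d := by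
    have h := card_meeting_mul_le (σ := 2 * Z.len) hV (mod_cast Z.separated)
    rw [← NNReal.coe_le_coe] at h hd ⊢
    push_cast at h hd ⊢
    linarith
  have hleft := Z.card_left_pos
  rw [proportion, density, div_le_iff₀ hleft]
  calc (#(Z.meeting V) : ℝ≥0) ≤ 2 * d / Z.len := (le_div_iff₀ hlen).2 hcard
    _ = 2 * ((#Z.left * Z.len)⁻¹ * d) * #Z.left := by field_simp

/-- `Z.Refines Z' N`: the family `Z'` consists of `N` intervals in each of the intervals of `Z`.
They are short compared with `Z.len / N` and spread out almost evenly. -/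
structure Refines (Z Z' : IntervalFamily) (N : ℕ) : Prop where
  two_le : 2 ≤ N
  len_le : 4 * N * Z'.len ≤ Z.len
  separated : (Z'.left : Set ℝ).Pairwise fun x y => (Z.len / (2 * N) : ℝ) ≤ dist x y
  exists_parent : ∀ y ∈ Z'.left, ∃ x ∈ Z.left, Z'.interval y ⊆ Z.interval x
  card_children : ∀ x ∈ Z.left, #(Z.children Z' x) = N

namespace Refines

theorem branching_pos (h : Z.Refines Z' N) : (0 : ℝ≥0) < N :=
  Nat.cast_pos.2 (two_pos.trans_le h.two_le)

theorem carrier_subset (h : Z.Refines Z' N) : Z'.carrier ⊆ Z.carrier :=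
  iUnion₂_subset fun y hy =>
    let ⟨_, hx, hxy⟩ := h.exists_parent y hy
    hxy.trans (interval_subset_carrier hx)

theorem card_left (h : Z.Refines Z' N) : #Z'.left = N * #Z.left := by
  have hdisj : (Z.left : Set ℝ).PairwiseDisjoint (Z.children Z') := by
    intro x hx x' hx' hne
    refine Finset.disjoint_left.2 fun y hy hy' => ?_
    exact Set.disjoint_left.1 (Z.pairwiseDisjoint_interval hx hx' hne)
      ((mem_children.1 hy).2 (Z'.left_mem_interval y))
      ((mem_children.1 hy').2 (Z'.left_mem_interval y))
  have hleft : Z'.left = Z.left.biUnion (Z.children Z') := by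
    ext y
    simp only [Finset.mem_biUnion, mem_children]
    exact ⟨fun hy => let ⟨x, hx, hxy⟩ := h.exists_parent y hy; ⟨x, hx, hy, hxy⟩,
      fun ⟨_, _, hy, _⟩ => hy⟩
  rw [hleft, Finset.card_biUnion hdisj, Finset.sum_const_nat h.card_children, mul_comm]

theorem card_left_cast (h : Z.Refines Z' N) : (#Z'.left : ℝ≥0) = N * #Z.left :=
  mod_cast h.card_left

theorem proportion_le (h : Z.Refines Z' N) (V : Set ℝ) : Z'.proportion V ≤ Z.proportion V := by
  have hsub : Z'.meeting V ⊆ (Z.meeting V).biUnion (Z.children Z') := by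
    intro y hy
    obtain ⟨hy, hyV⟩ := mem_meeting.1 hy
    obtain ⟨x, hx, hxy⟩ := h.exists_parent y hy
    exact Finset.mem_biUnion.2 ⟨x, mem_meeting.2 ⟨hx, hyV.mono (inter_subset_inter_left V hxy)⟩,
      mem_children.2 ⟨hy, hxy⟩⟩
  have hcard : #(Z'.meeting V) ≤ #(Z.meeting V) * N :=
    (Finset.card_le_card hsub).trans
      (Finset.card_biUnion_le_card_mul _ _ _ fun x hx =>
        (h.card_children x (mem_meeting.1 hx).1).le)
  calc Z'.proportion V ≤ (#(Z.meeting V) * N) / (#Z.left * N) := by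
        rw [proportion, h.card_left_cast, mul_comm (N : ℝ≥0)]
        gcongr
        exact_mod_cast hcard
    _ = Z.proportion V := mul_div_mul_right _ _ h.branching_pos.ne'

theorem len_le_div (h : Z.Refines Z' N) : Z'.len ≤ Z.len / (4 * N) := by
  have hN := h.branching_pos
  rw [le_div_iff₀ (by positivity), mul_comm]
  exact h.len_le

theorem inv_card_left_eq (h : Z.Refines Z' N) :
    (#Z'.left : ℝ≥0)⁻¹ = Z.density * (Z.len / N) := by
  have hlen := Z.len_pos
  rw [h.card_left_cast, density]
  field_simp

theorem density_mul_len_le (h : Z.Refines Z' N) : Z.density * Z'.len ≤ (#Z'.left : ℝ≥0)⁻¹ := by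
  rw [h.inv_card_left_eq]
  gcongr
  refine h.len_le_div.trans ?_
  have hN := h.branching_pos
  gcongr
  exact le_mul_of_one_le_left' (by norm_num)

theorem density_le (h : Z.Refines Z' N) : Z.density ≤ Z'.density := by
  rw [density.eq_1 Z', mul_inv, ← div_eq_mul_inv, le_div_iff₀ Z'.len_pos]
  exact h.density_mul_len_le

/-- Below the scale `Z.len / N` a set meets essentially at most one of the intervals of `Z'`, above
that scale the intervals of `Z'` look like the uniform distribution on `Z`. -/
theorem proportion_le_max (h : Z.Refines Z' N) (hV : Metric.ediam V ≤ d) :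
    Z'.proportion V ≤ 4 * max (#Z'.left : ℝ≥0)⁻¹ (Z.density * d) := by
  have hN := h.branching_pos
  have hlen := Z.len_pos
  set σ := Z.len / (2 * N) with hσ
  have hσ_pos : 0 < σ := by positivity
  have hcard : #(Z'.meeting V) ≤ 2 + d / σ := by
    have hmul := card_meeting_mul_le (σ := σ) hV (by simpa [hσ] using h.separated)
    have hlen' : Z'.len ≤ σ := h.len_le_div.trans (by rw [hσ]; gcongr; norm_num)
    rw [← mul_le_mul_iff_left₀ hσ_pos, add_mul, div_mul_cancel₀ _ hσ_pos.ne']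
    calc #(Z'.meeting V) * σ ≤ d + Z'.len + σ := hmul
      _ ≤ d + σ + σ := by gcongr
      _ = 2 * σ + d := by ring
  calc Z'.proportion V ≤ (2 + d / σ) / #Z'.left := by rw [proportion]; gcongr
    _ = 2 * (#Z'.left : ℝ≥0)⁻¹ + 2 * (Z.density * d) := by
        rw [div_eq_mul_inv, h.inv_card_left_eq, hσ]
        field_simp
    _ ≤ 2 * max (#Z'.left : ℝ≥0)⁻¹ (Z.density * d) +
          2 * max (#Z'.left : ℝ≥0)⁻¹ (Z.density * d) := by
        gcongr
        exacts [le_max_left _ _, le_max_right _ _]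
    _ = 4 * max (#Z'.left : ℝ≥0)⁻¹ (Z.density * d) := by ring

end Refines

theorem pairwise_le_dist_biUnion (Z : IntervalFamily) {T : ℝ → Finset ℝ} {σ : ℝ}
    (hσ : σ ≤ Z.len) (hT : ∀ x, ∀ y ∈ T x, y ∈ Z.interval x)
    (hsep : ∀ x, (T x : Set ℝ).Pairwise fun y z => σ ≤ dist y z) :
    (Z.left.biUnion T : Set ℝ).Pairwise fun y z => σ ≤ dist y z := by
  intro y hy y' hy' hne
  obtain ⟨x, hx, hyx⟩ := Finset.mem_biUnion.1 hy
  obtain ⟨x', hx', hyx'⟩ := Finset.mem_biUnion.1 hy'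
  rcases eq_or_ne x x' with rfl | hxx
  · exact hsep x hyx hyx' hne
  have hdist : dist x x' ≤ dist y y' + Z.len := by
    have hyy := abs_sub_le_iff.1 (Real.dist_eq y y').ge
    obtain ⟨h, h'⟩ := hT x y hyx
    obtain ⟨k, k'⟩ := hT x' y' hyx'
    exact abs_sub_le_iff.2 ⟨by linarith, by linarith⟩
  linarith [Z.separated hx hx' hxx]

theorem exists_refines_of_children (Z : IntervalFamily) (hN : 2 ≤ N) {T : ℝ → Finset ℝ} {r : ℝ≥0}
    (hr : 0 < r) (hrZ : 4 * N * r ≤ Z.len) (hcard : ∀ x, #(T x) = N)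
    (hT : ∀ x, ∀ y ∈ T x, x ≤ y ∧ y + r ≤ x + Z.len)
    (hsep : ∀ x, (T x : Set ℝ).Pairwise fun y z => (Z.len / (2 * N) : ℝ) ≤ dist y z) :
    ∃ Z' : IntervalFamily, Z.Refines Z' N ∧ Z'.left = Z.left.biUnion T ∧ Z'.len = r := by
  have hN' : (2 : ℝ) ≤ N := by exact_mod_cast hN
  have hrZ' : (4 * N * r : ℝ) ≤ Z.len := by exact_mod_cast hrZ
  have hwZ : (Z.len / (2 * N) : ℝ) ≤ Z.len := by
    rw [div_le_iff₀ (by positivity)]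
    nlinarith [Z.len.coe_nonneg]
  have hrw : 2 * (r : ℝ) ≤ Z.len / (2 * N) := by
    rw [le_div_iff₀ (by positivity)]
    linarith [hrZ']
  have hT' x y (hy : y ∈ T x) : y ∈ Z.interval x :=
    ⟨(hT x y hy).1, by linarith [(hT x y hy).2, r.coe_nonneg]⟩
  have hsep' := Z.pairwise_le_dist_biUnion hwZ hT' hsep
  have hne : (Z.left.biUnion T).Nonempty :=
    Z.left_nonempty.biUnion fun x _ => Finset.card_pos.1 (by rw [hcard x]; lia)
  let Z' : IntervalFamily := ⟨Z.left.biUnion T, r, hne, hr, hsep'.mono' fun _ _ => hrw.trans⟩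
  have hchild {x y : ℝ} (hy : y ∈ T x) : Z'.interval y ⊆ Z.interval x :=
    Icc_subset_Icc (hT x y hy).1 (hT x y hy).2
  refine ⟨Z', ⟨hN, hrZ, hsep', fun y hy => ?_, fun x hx => ?_⟩, rfl, rfl⟩
  · obtain ⟨x, hx, hyx⟩ := Finset.mem_biUnion.1 hy
    exact ⟨x, hx, hchild hyx⟩
  · have hTx : Z.children Z' x = T x := by
      ext y
      refine ⟨fun hy => ?_, fun hy =>
        mem_children.2 ⟨Finset.mem_biUnion.2 ⟨x, hx, hy⟩, hchild hy⟩⟩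
      obtain ⟨hy, hyx⟩ := mem_children.1 hy
      obtain ⟨x', hx', hyx'⟩ := Finset.mem_biUnion.1 hy
      have hmem := Z'.left_mem_interval y
      rwa [Z.pairwiseDisjoint_interval.elim_set hx hx' y (hyx hmem) (hchild hyx' hmem)]
    rw [hTx, hcard]

theorem exists_refines (Z : IntervalFamily) (hN : 2 ≤ N) {U : Set ℝ} (hU : IsOpen U)
    (hd : Dense U) : ∃ Z', Z.Refines Z' N ∧ Z'.carrier ⊆ U := by
  have hlen := Z.len_pos
  have hN_pos : 0 < N := two_pos.trans_le hN
  choose T hcard hTU hsep using fun x =>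
    exists_separated_finset_of_dense hd x (NNReal.coe_pos.2 hlen) hN_pos
  have hsub : ((Z.left.biUnion T : Finset ℝ) : Set ℝ) ⊆ U := by
    intro y hy
    obtain ⟨x, -, hyx⟩ := Finset.mem_biUnion.1 hy
    exact (hTU x hyx).1
  obtain ⟨δ, hδ, hδU⟩ :=
    (Finset.finite_toSet _).isCompact.exists_cthickening_subset_open hU hsub
  have : (0 : ℝ≥0) < N := Nat.cast_pos.2 hN_pos
  set r : ℝ≥0 := min δ.toNNReal (Z.len / (4 * N))
  have hr : 0 < r := lt_min (Real.toNNReal_pos.2 hδ) (by positivity)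
  have hrZ : 4 * N * r ≤ Z.len := by
    rw [mul_comm, ← le_div_iff₀ (by positivity)]
    exact min_le_right _ _
  have hrw : (r : ℝ) ≤ Z.len / (2 * N) := by
    refine NNReal.coe_le_coe.2 ((min_le_right _ _).trans ?_ : r ≤ Z.len / (2 * N))
    gcongr
    norm_num
  obtain ⟨Z', hZ', hleft, hlen'⟩ := Z.exists_refines_of_children hN hr hrZ hcard
    (fun x y hy => ⟨(hTU x hy).2.1, by linarith [(hTU x hy).2.2]⟩) hsep
  refine ⟨Z', hZ', iUnion₂_subset fun y hy => ?_⟩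
  have hrδ : (Z'.len : ℝ) ≤ δ := by
    rw [hlen', ← Real.coe_toNNReal δ hδ.le]
    exact NNReal.coe_le_coe.2 (min_le_left _ _)
  calc Z'.interval y ⊆ Metric.closedBall y δ := by
        rw [Real.closedBall_eq_Icc]
        exact Icc_subset_Icc (by linarith) (by linarith)
    _ ⊆ Metric.cthickening δ (Z.left.biUnion T : Finset ℝ) :=
        Metric.closedBall_subset_cthickening (hleft ▸ hy) δ
    _ ⊆ U := hδU

theorem exists_carrier_subset_Ioo {a b : ℝ} (hab : a < b) :
    ∃ Z : IntervalFamily, Z.carrier ⊆ Ioo a b := by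
  refine ⟨⟨{(2 * a + b) / 3}, ((b - a) / 3).toNNReal, by simp, by simpa using hab, by simp⟩, ?_⟩
  have hlen : (((b - a) / 3).toNNReal : ℝ) = (b - a) / 3 := Real.coe_toNNReal _ (by linarith)
  simp only [carrier, interval, Finset.mem_singleton, iUnion_iUnion_eq_left, hlen]
  exact Icc_subset_Ioo (by linarith) (by linarith)

end IntervalFamily

/-- The infimum of the ramps `x ↦ max (a n) (K n * x)`: a gauge function whose values are at
most `K n * x` as soon as this exceeds `a n`. -/
noncomputable def rampGauge (a K : ℕ → ℝ≥0) (x : ℝ≥0) : ℝ≥0 := ⨅ n, max (a n) (K n * x)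

theorem rampGauge_le (a K : ℕ → ℝ≥0) (x : ℝ≥0) (n : ℕ) :
    rampGauge a K x ≤ max (a n) (K n * x) :=
  ciInf_le (OrderBot.bddBelow _) n

theorem isGauge_rampGauge (a K : ℕ → ℝ≥0) : IsGauge (rampGauge a K) := by
  have hmono : Monotone (rampGauge a K) := fun x y h =>
    le_ciInf fun n => (rampGauge_le a K x n).trans (by gcongr)
  refine ⟨hmono, fun x => tendsto_order.2 ⟨fun b hb => ?_, fun b hb => ?_⟩⟩
  · filter_upwards [self_mem_nhdsWithin] with y hy
    exact hb.trans_le (hmono hy)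
  · obtain ⟨n, hn⟩ := exists_lt_of_ciInf_lt hb
    have hramp : Continuous fun y : ℝ≥0 => max (a n) (K n * y) := by fun_prop
    filter_upwards [hramp.continuousWithinAt.eventually_lt_const hn] with y hy
    exact (rampGauge_le a K y n).trans_lt hy

theorem rampGauge_zero {a : ℕ → ℝ≥0} (ha : Tendsto a atTop (𝓝 0)) (K : ℕ → ℝ≥0) :
    rampGauge a K 0 = 0 := by
  refine le_antisymm (ge_of_tendsto' ha fun n => ?_) zero_le
  simpa using rampGauge_le a K 0 n

/-- A sequence of successively refined interval families, which defines a Cantor set. -/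
structure CantorScheme where
  stage : ℕ → IntervalFamily
  branching : ℕ → ℕ
  refines : ∀ n, (stage n).Refines (stage (n + 1)) (branching n)

namespace CantorScheme

/-- The Cantor set defined by the scheme. -/
def limitSet (S : CantorScheme) : Set ℝ := ⋂ n, (S.stage n).carrier

/-- A gauge function for which the Hausdorff measure of the Cantor set is positive and finite. On
scales between the lengths of the stages `n` and `n + 1` it follows the mass that an interval can
have under the uniform distribution of the Cantor set: at least one interval of stage `n + 1`, and
the uniform density of stage `n` otherwise. -/
noncomputable def gauge (S : CantorScheme) : ℝ≥0 → ℝ≥0 :=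
  rampGauge (fun n => (#(S.stage (n + 1)).left : ℝ≥0)⁻¹) fun n => (S.stage n).density

variable (S : CantorScheme) {d : ℝ≥0} {n : ℕ}

theorem isGauge_gauge : IsGauge S.gauge := isGauge_rampGauge _ _

theorem limitSet_subset_carrier (n : ℕ) : S.limitSet ⊆ (S.stage n).carrier := iInter_subset _ n

theorem isCompact_limitSet : IsCompact S.limitSet :=
  (S.stage 0).isCompact_carrier.of_isClosed_subset
    (isClosed_iInter fun n => (S.stage n).isCompact_carrier.isClosed) (S.limitSet_subset_carrier 0)

theorem antitone_carrier : Antitone fun n => (S.stage n).carrier :=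
  antitone_nat_of_succ_le fun n => (S.refines n).carrier_subset

theorem antitone_proportion (V : Set ℝ) : Antitone fun n => (S.stage n).proportion V :=
  antitone_nat_of_succ_le fun n => (S.refines n).proportion_le V

theorem monotone_density : Monotone fun n => (S.stage n).density :=
  monotone_nat_of_le_succ fun n => (S.refines n).density_le

theorem strictMono_card_left : StrictMono fun n => #(S.stage n).left :=
  strictMono_nat_of_lt_succ fun n => by
    rw [(S.refines n).card_left]
    exact lt_mul_left (S.stage n).left_nonempty.card_pos (S.refines n).two_le

theorem tendsto_len : Tendsto (fun n => (S.stage n).len) atTop (𝓝 0) := by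
  have hstep n : ((S.stage (n + 1)).len : ℝ) ≤ 1 / 2 * (S.stage n).len := by
    have hN : (2 : ℝ) ≤ S.branching n := mod_cast (S.refines n).two_le
    have hlen : (4 * S.branching n * (S.stage (n + 1)).len : ℝ) ≤ (S.stage n).len :=
      mod_cast (S.refines n).len_le
    nlinarith [(S.stage (n + 1)).len.coe_nonneg]
  have hlim : Tendsto (fun n : ℕ => (1 / 2 : ℝ) ^ n * (S.stage 0).len) atTop (𝓝 0) := by
    simpa using (tendsto_pow_atTop_nhds_zero_of_lt_one (by norm_num : (0 : ℝ) ≤ 1 / 2)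
      (by norm_num)).mul_const ((S.stage 0).len : ℝ)
  exact NNReal.tendsto_coe.1 (squeeze_zero (fun n => NNReal.coe_nonneg _)
    (fun n => le_geom (u := fun n => ((S.stage n).len : ℝ)) (by norm_num) n fun k _ => hstep k)
    hlim)

theorem gauge_zero : S.gauge 0 = 0 := by
  have hcard : Tendsto (fun n => (#(S.stage (n + 1)).left : ℝ≥0)) atTop atTop :=
    tendsto_natCast_atTop_atTop.comp
      ((tendsto_add_atTop_iff_nat 1).2 S.strictMono_card_left.tendsto_atTop)
  exact rampGauge_zero hcard.inv_tendsto_atTop _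

theorem gauge_le_max (n : ℕ) (d : ℝ≥0) :
    S.gauge d ≤ max (#(S.stage (n + 1)).left : ℝ≥0)⁻¹ ((S.stage n).density * d) :=
  rampGauge_le _ _ d n

theorem gauge_le_density_mul (hd : (S.stage n).len / S.branching n ≤ d) :
    S.gauge d ≤ (S.stage n).density * d := by
  refine (S.gauge_le_max n d).trans (max_le ?_ le_rfl)
  rw [(S.refines n).inv_card_left_eq]
  gcongr

theorem gauge_len_succ_le (n : ℕ) :
    S.gauge (S.stage (n + 1)).len ≤ (#(S.stage (n + 1)).left : ℝ≥0)⁻¹ :=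
  (S.gauge_le_max n _).trans (max_le le_rfl (S.refines n).density_mul_len_le)

theorem proportion_le_gauge {V : Set ℝ} (hn : (S.stage n).len ≤ d) (hV : Metric.ediam V ≤ d) :
    (S.stage n).proportion V ≤ 4 * S.gauge d := by
  rw [← div_le_iff₀' four_pos]
  refine le_ciInf fun m => ?_
  rw [div_le_iff₀' four_pos]
  rcases lt_or_ge m n with hmn | hnm
  · exact (S.antitone_proportion V hmn).trans ((S.refines m).proportion_le_max hV)
  · calc (S.stage n).proportion V ≤ 2 * ((S.stage n).density * d) :=
          IntervalFamily.proportion_le_density_mul hn hV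
      _ ≤ 4 * ((S.stage m).density * d) := by
          gcongr
          exacts [by norm_num, S.monotone_density hnm]
      _ ≤ 4 * max (#(S.stage (m + 1)).left : ℝ≥0)⁻¹ ((S.stage m).density * d) := by
          gcongr
          exact le_max_right _ _

theorem one_le_sum_gauge {V : ℕ → Set ℝ} {d : ℕ → ℝ≥0} {t : Finset ℕ} (hVo : ∀ i, IsOpen (V i))
    (hV : ∀ i, Metric.ediam (V i) ≤ d i) (hd : ∀ i, 0 < d i) (ht : S.limitSet ⊆ ⋃ i ∈ t, V i) :
    1 ≤ 4 * ∑ i ∈ t, S.gauge (d i) := by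
  obtain ⟨n₀, hn₀⟩ := exists_subset_nhds_of_isCompact S.antitone_carrier.directed_ge
    (fun n => (S.stage n).isCompact_carrier)
    (fun x hx => (isOpen_biUnion fun i _ => hVo i).mem_nhds (ht hx))
  have hlen : ∀ᶠ n in atTop, ∀ i ∈ t, (S.stage n).len ≤ d i :=
    (eventually_all_finset t).2 fun i _ => S.tendsto_len.eventually_le_const (hd i)
  obtain ⟨n, hnd, hn⟩ := (hlen.and (eventually_ge_atTop n₀)).exists
  calc 1 ≤ ∑ i ∈ t, (S.stage n).proportion (V i) :=
        IntervalFamily.one_le_sum_proportion ((S.antitone_carrier hn).trans hn₀)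
    _ ≤ ∑ i ∈ t, 4 * S.gauge (d i) :=
        Finset.sum_le_sum fun i hi => S.proportion_le_gauge (hnd i hi) (hV i)
    _ = 4 * ∑ i ∈ t, S.gauge (d i) := (Finset.mul_sum _ _ _).symm

theorem gaugeHausdorff_limitSet_pos : 0 < gaugeHausdorff S.gauge S.limitSet := by
  have hquarter : (0 : ℝ≥0∞) < (1 / 4 : ℝ≥0) := by simp
  refine hquarter.trans_le (le_gaugeHausdorff_of_isCompact S.isGauge_gauge S.gauge_zero
    S.isCompact_limitSet fun V d t hVo hV hd ht => ?_)
  have hsum : (1 / 4 : ℝ≥0) ≤ ∑ i ∈ t, S.gauge (d i) :=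
    (div_le_iff₀' four_pos).2 (S.one_le_sum_gauge hVo hV hd ht)
  exact_mod_cast hsum

theorem gaugeHausdorff_limitSet_le_one : gaugeHausdorff S.gauge S.limitSet ≤ 1 := by
  have hlen : Tendsto (fun n => ((S.stage (n + 1)).len : ℝ≥0∞)) atTop (𝓝 0) :=
    ENNReal.tendsto_coe.2 ((tendsto_add_atTop_iff_nat 1).2 S.tendsto_len)
  have hcover n : S.limitSet ⊆
      ⋃ x : (S.stage (n + 1)).left, (S.stage (n + 1)).interval x := by
    rw [iUnion_subtype]
    exact S.limitSet_subset_carrier (n + 1)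
  calc gaugeHausdorff S.gauge S.limitSet
      ≤ liminf (fun n => ∑ x : (S.stage (n + 1)).left, (S.gauge
          (Metric.ediam ((S.stage (n + 1)).interval x)).toNNReal : ℝ≥0∞)) atTop :=
        Measure.mkMetric_le_liminf_sum _ _ hlen _
          (Eventually.of_forall fun n x => (IntervalFamily.ediam_interval _ _).le)
          (Eventually.of_forall hcover) _
    _ ≤ liminf (fun _ : ℕ => (1 : ℝ≥0∞)) atTop := by
        refine liminf_le_liminf (Eventually.of_forall fun n => ?_)
        have hmass : #(S.stage (n + 1)).left * S.gauge (S.stage (n + 1)).len ≤ 1 := by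
          rw [← le_div_iff₀' (S.stage (n + 1)).card_left_pos, one_div]
          exact S.gauge_len_succ_le n
        simp only [IntervalFamily.ediam_interval, ENNReal.toNNReal_coe, Finset.sum_const,
          Finset.card_univ, Fintype.card_coe, nsmul_eq_mul]
        exact_mod_cast hmass
    _ = 1 := liminf_const 1

theorem measuredByHausdorff_of_diff_null {A : Set ℝ} (hA : S.limitSet ⊆ A)
    (hnull : gaugeHausdorff S.gauge (A \ S.limitSet) = 0) : MeasuredByHausdorff A := by
  refine ⟨S.gauge, S.isGauge_gauge, S.gauge_zero,
    S.gaugeHausdorff_limitSet_pos.trans_le (measure_mono hA), ?_⟩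
  have hfin : gaugeHausdorff S.gauge A < ∞ := by
    calc gaugeHausdorff S.gauge A
        ≤ gaugeHausdorff S.gauge (A \ S.limitSet) + gaugeHausdorff S.gauge S.limitSet := by
          refine (measure_mono ?_).trans (measure_union_le _ _)
          rw [sdiff_union_self]
          exact subset_union_left
      _ ≤ 1 := by rw [hnull, zero_add]; exact S.gaugeHausdorff_limitSet_le_one
      _ < ∞ := ENNReal.one_lt_top
  have : IsFiniteMeasure ((gaugeHausdorff S.gauge).restrict A) :=
    ⟨by rwa [Measure.restrict_apply_univ]⟩
  infer_instance

theorem tsum_gauge_ne_top {κ : Type*} {ℓ : κ → ℝ≥0} {J : ℕ → Set κ}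
    (hscale : ∀ n, ∀ k ∈ J n, (S.stage n).len / S.branching n ≤ ℓ k)
    (hsum : ∀ n, (S.stage n).density * ∑' k : J n, (ℓ k : ℝ≥0∞) ≤ 2⁻¹ ^ n) :
    ∑' k : ⋃ n, J n, (S.gauge (ℓ k) : ℝ≥0∞) ≠ ∞ := by
  have hblock n : ∑' k : J n, (S.gauge (ℓ k) : ℝ≥0∞) ≤ 2⁻¹ ^ n := by
    refine le_trans ?_ (hsum n)
    rw [← ENNReal.tsum_mul_left]
    exact ENNReal.tsum_le_tsum fun k => mod_cast S.gauge_le_density_mul (hscale n k k.2)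
  refine ne_top_of_le_ne_top ENNReal.ofNat_ne_top (b := 2) ?_
  calc ∑' k : ⋃ n, J n, (S.gauge (ℓ k) : ℝ≥0∞)
      ≤ ∑' n, ∑' k : J n, (S.gauge (ℓ k) : ℝ≥0∞) :=
        ENNReal.tsum_iUnion_le_tsum (fun k => (S.gauge (ℓ k) : ℝ≥0∞)) J
    _ ≤ ∑' n, 2⁻¹ ^ n := ENNReal.tsum_le_tsum hblock
    _ = 2 := ENNReal.tsum_geometric_two

end CantorScheme

theorem exists_gt_mul_tsum_Ici_le {ℓ : ℕ → ℝ≥0} (hℓ : ∑' k, (ℓ k : ℝ≥0∞) ≠ ∞) (K : ℝ≥0)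
    {ε : ℝ≥0∞} (hε : 0 < ε) (s : ℕ) : ∃ t > s, K * ∑' k : Ici t, (ℓ k : ℝ≥0∞) ≤ ε := by
  have htail : Tendsto (fun t : ℕ => ∑' k : Ici t, (ℓ k : ℝ≥0∞)) atTop (𝓝 0) := by
    refine ((ENNReal.tendsto_tsum_compl_atTop_zero hℓ).comp tendsto_finset_range).congr fun t => ?_
    have hIci : {k | k ∉ Finset.range t} = Ici t := by ext k; simp
    exact congrArg (fun u : Set ℕ => ∑' k : u, (ℓ k : ℝ≥0∞)) hIci
  have hmul : Tendsto (fun t : ℕ => K * ∑' k : Ici t, (ℓ k : ℝ≥0∞)) atTop (𝓝 0) := by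
    simpa using ENNReal.Tendsto.const_mul htail (Or.inr (ENNReal.coe_ne_top (r := K)))
  exact ((eventually_gt_atTop s).and (hmul.eventually_le_const hε)).exists

theorem IntervalFamily.exists_refines_of_scale {ι : Type*} (Z : IntervalFamily) (s : Finset ι)
    {ℓ : ι → ℝ≥0} (hℓ : ∀ k, 0 < ℓ k) {U : Set ℝ} (hU : IsOpen U) (hd : Dense U) :
    ∃ (Z' : IntervalFamily) (N : ℕ), Z.Refines Z' N ∧ Z'.carrier ⊆ U ∧
      ∀ k ∈ s, Z.len / N ≤ ℓ k := by
  have hscale : ∀ᶠ N : ℕ in atTop, ∀ k ∈ s, Z.len / N ≤ ℓ k :=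
    (eventually_all_finset s).2 fun k _ =>
      (tendsto_const_div_atTop_nhds_zero_nat Z.len).eventually_le_const (hℓ k)
  obtain ⟨N, hN, hN₂⟩ := (hscale.and (eventually_ge_atTop 2)).exists
  obtain ⟨Z', hZ', hZ'U⟩ := Z.exists_refines hN₂ hU hd
  exact ⟨Z', N, hZ', hZ'U, hN⟩

theorem IntervalFamily.exists_interleaved_seq {ℓ : ℕ → ℝ≥0} (hℓ_pos : ∀ k, 0 < ℓ k)
    (hℓ : ∑' k, (ℓ k : ℝ≥0∞) ≠ ∞) {U : ℕ → Set ℝ} (hU : ∀ n, IsOpen (U n))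
    (hd : ∀ n, Dense (U n)) (A B : IntervalFamily) :
    ∃ (Z : ℕ → IntervalFamily) (N t : ℕ → ℕ), Z 0 = A ∧ Z 1 = B ∧ StrictMono t ∧
      (∀ n, (Z n).Refines (Z (n + 2)) (N n)) ∧ (∀ n, (Z (n + 2)).carrier ⊆ U n) ∧
      (∀ n, (Z n).density * ∑' k : Ici (t n), (ℓ k : ℝ≥0∞) ≤ 2⁻¹ ^ n) ∧
      ∀ n, ∀ k < t (n + 1), (Z n).len / N n ≤ ℓ k := by
  have hε n : (0 : ℝ≥0∞) < 2⁻¹ ^ n := ENNReal.pow_pos (by simp) n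
  choose τ hτ hτ_tail using fun n (Y : IntervalFamily) =>
    exists_gt_mul_tsum_Ici_le hℓ Y.density (hε n)
  choose R N hR hRU hN using fun n (X : IntervalFamily) t =>
    X.exists_refines_of_scale (Finset.range t) hℓ_pos (hU n) (hd n)
  -- The state at time `n` consists of `Z n`, `Z (n + 1)` and `t n`.
  let state : ℕ → IntervalFamily × IntervalFamily × ℕ := Nat.rec (A, B, τ 0 A 0) fun n p =>
    (p.2.1, R n p.1 (τ (n + 1) p.2.1 p.2.2), τ (n + 1) p.2.1 p.2.2)
  refine ⟨fun n => (state n).1, fun n => N n (state n).1 (state (n + 1)).2.2,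
    fun n => (state n).2.2, rfl, rfl, strictMono_nat_of_lt_succ fun n => hτ _ _ _,
    fun n => hR _ _ _, fun n => hRU _ _ _, ?_, fun n k hk => hN _ _ _ k (Finset.mem_range.2 hk)⟩
  rintro (_ | n)
  exacts [hτ_tail 0 A 0, hτ_tail (n + 1) _ _]

theorem CantorScheme.exists_interleaved {ℓ : ℕ → ℝ≥0} (hℓ_pos : ∀ k, 0 < ℓ k)
    (hℓ : ∑' k, (ℓ k : ℝ≥0∞) ≠ ∞) {U : ℕ → Set ℝ} (hU : ∀ n, IsOpen (U n))
    (hd : ∀ n, Dense (U n)) (A B : IntervalFamily) :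
    ∃ (S T : CantorScheme) (J K : Set ℕ), S.stage 0 = A ∧ T.stage 0 = B ∧
      S.limitSet ⊆ ⋂ n, U n ∧ T.limitSet ⊆ ⋂ n, U n ∧ (∀ᶠ k in atTop, k ∈ J ∪ K) ∧
      ∑' k : J, (S.gauge (ℓ k) : ℝ≥0∞) ≠ ∞ ∧ ∑' k : K, (T.gauge (ℓ k) : ℝ≥0∞) ≠ ∞ := by
  obtain ⟨Z, N, t, hA, hB, ht, hZ, hZU, htail, hN⟩ :=
    IntervalFamily.exists_interleaved_seq hℓ_pos hℓ (fun n => hU (n / 2)) (fun n => hd (n / 2)) A B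
  let S (i : ℕ) : CantorScheme :=
    ⟨fun n => Z (2 * n + i), fun n => N (2 * n + i), fun n => by
      simpa only [show 2 * (n + 1) + i = 2 * n + i + 2 by ring] using hZ (2 * n + i)⟩
  let J (i : ℕ) : Set ℕ := ⋃ n, Ico (t (2 * n + i)) (t (2 * n + i + 1))
  have hSU {i : ℕ} (hi : i < 2) : (S i).limitSet ⊆ ⋂ n, U n := by
    refine subset_iInter fun n => ((S i).limitSet_subset_carrier (n + 1)).trans ?_
    have h := hZU (2 * n + i)
    rwa [show (2 * n + i) / 2 = n by lia, show 2 * n + i + 2 = 2 * (n + 1) + i by ring] at h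
  have hJ (i : ℕ) : ∑' k : J i, ((S i).gauge (ℓ k) : ℝ≥0∞) ≠ ∞ := by
    refine (S i).tsum_gauge_ne_top (fun n k hk => hN _ k hk.2) fun n => ?_
    calc (Z (2 * n + i)).density * ∑' k : Ico (t (2 * n + i)) (t (2 * n + i + 1)), (ℓ k : ℝ≥0∞)
        ≤ (Z (2 * n + i)).density * ∑' k : Ici (t (2 * n + i)), (ℓ k : ℝ≥0∞) := by
          gcongr
          exact ENNReal.tsum_mono_subtype (fun k => (ℓ k : ℝ≥0∞)) Ico_subset_Ici_self
      _ ≤ 2⁻¹ ^ (2 * n + i) := htail _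
      _ ≤ 2⁻¹ ^ n := pow_le_pow_right_of_le_one' (by simp) (by lia)
  have hcover : ∀ᶠ k in atTop, k ∈ J 0 ∪ J 1 := by
    filter_upwards [eventually_ge_atTop (t 0)] with k hk
    have hIci : ⋃ n, Ico (t n) (t (n + 1)) = Ici (t 0) :=
      iUnion_Ico_map_succ_eq_Ici (fun n => ht.monotone n.zero_le)
        (not_bddAbove_of_tendsto_atTop ht.tendsto_atTop)
    obtain ⟨n, hn⟩ := mem_iUnion.1 (hIci.ge hk)
    rcases Nat.even_or_odd' n with ⟨m, rfl | rfl⟩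
    exacts [Or.inl (mem_iUnion.2 ⟨m, hn⟩), Or.inr (mem_iUnion.2 ⟨m, hn⟩)]
  exact ⟨S 0, S 1, J 0, J 1, hA, hB, hSU two_pos, hSU one_lt_two, hcover, hJ 0, hJ 1⟩

theorem exists_measurableSet_diff_null {α : Type*} [MeasurableSpace α] {μ ν : Measure α}
    {B K L D E : Set α} (hK : MeasurableSet K) (hL : MeasurableSet L) (hKL : Disjoint K L)
    (hD : μ D = 0) (hE : ν E = 0) (hB : B ⊆ D ∪ E) :
    ∃ C, MeasurableSet C ∧ K ⊆ C ∧ Disjoint C L ∧ μ (C \ K) = 0 ∧ ν ((B \ C) \ L) = 0 := by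
  refine ⟨(K ∪ toMeasurable μ D) \ L, (hK.union (measurableSet_toMeasurable μ D)).diff hL,
    subset_sdiff.2 ⟨subset_union_left, hKL⟩, disjoint_sdiff_left, ?_, ?_⟩
  · refine measure_mono_null ?_ ((measure_toMeasurable D).trans hD)
    rintro x ⟨⟨hx, -⟩, hxK⟩
    exact hx.resolve_left hxK
  · refine measure_mono_null ?_ hE
    rintro x ⟨⟨hxB, hxC⟩, hxL⟩
    have hxD : x ∉ D := fun hxD => hxC ⟨Or.inr (subset_toMeasurable μ D hxD), hxL⟩
    exact (hB hxB).resolve_left hxD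

theorem exists_measure_Iio_pos_measure_Ici_pos {μ : Measure ℝ} [NullSingletonClass μ] (hμ : μ ≠ 0) :
    ∃ c, 0 < μ (Iio c) ∧ 0 < μ (Ici c) := by
  have hne (b : ℝ) : ∃ᵐ x ∂μ, id x ≠ b := by
    intro hb
    have hcompl : μ {b}ᶜ = 0 := by simpa [ae_iff, compl_def] using hb
    exact hμ (Measure.measure_univ_eq_zero.1 (compl_union_self {b} ▸
      measure_union_null hcompl (measure_singleton b)))
  obtain ⟨a, b, hab, ha, hb⟩ := exists_ne_forall_mem_nhds_pos_measure_preimage hne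
  wlog hlt : a < b generalizing a b
  · exact this b a hab.symm hb ha (hab.symm.lt_of_le (not_lt.1 hlt))
  obtain ⟨c, hac, hcb⟩ := exists_between hlt
  exact ⟨c, ha _ (Iio_mem_nhds hac), hb _ (Ici_mem_nhds hcb)⟩

theorem exists_measuredByHausdorff_of_volume_ne_zero {B : Set ℝ} (hB : volume B ≠ 0) :
    ∃ C, MeasurableSet C ∧ MeasuredByHausdorff (B ∩ C) ∧ MeasuredByHausdorff (B \ C) := by
  obtain ⟨c, hIio, hIci⟩ := exists_measure_Iio_pos_measure_Ici_pos
    (mt Measure.restrict_eq_zero.1 hB)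
  rw [Measure.restrict_apply measurableSet_Iio, inter_comm] at hIio
  rw [Measure.restrict_apply measurableSet_Ici, inter_comm, ← compl_Iio, ← sdiff_eq] at hIci
  exact ⟨Iio c, measurableSet_Iio, measuredByHausdorff_of_volume_pos hIio,
    measuredByHausdorff_of_volume_pos hIci⟩

theorem exists_iInter_inter_Ioo_subset {B : Set ℝ} (hB : BaireMeasurableSet B)
    (hcat : ¬ IsMeagre B) :
    ∃ (U : ℕ → Set ℝ) (a b : ℝ), (∀ n, IsOpen (U n)) ∧ (∀ n, Dense (U n)) ∧ a < b ∧
      (⋂ n, U n) ∩ Ioo a b ⊆ B := by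
  obtain ⟨u, hu, hBu⟩ := hB.residualEq_isOpen
  have hne : u.Nonempty := by
    by_contra hempty
    rw [not_nonempty_iff_eq_empty] at hempty
    refine hcat ?_
    filter_upwards [hBu.mem_iff] with x hx
    simpa [hempty] using hx
  obtain ⟨x, hx⟩ := hne
  obtain ⟨a, b, ⟨hax, hxb⟩, hab⟩ := mem_nhds_iff_exists_Ioo_subset.1 (hu.mem_nhds hx)
  obtain ⟨G, hG, hG_Gδ, hG_dense⟩ := mem_residual.1 hBu.mem_iff
  obtain ⟨U, hU, rfl⟩ := isGδ_iff_eq_iInter_nat.1 hG_Gδ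
  exact ⟨U, a, b, hU, fun n => hG_dense.mono (iInter_subset U n), hax.trans hxb,
    fun y hy => (hG hy.1).2 (hab hy.2)⟩

theorem exists_measuredByHausdorff_of_volume_eq_zero {B : Set ℝ} (hB : BaireMeasurableSet B)
    (hcat : ¬ IsMeagre B) (hB₀ : volume B = 0) :
    ∃ C, MeasurableSet C ∧ MeasuredByHausdorff (B ∩ C) ∧ MeasuredByHausdorff (B \ C) := by
  obtain ⟨U, a, b, hU, hd, hab, hUB⟩ := exists_iInter_inter_Ioo_subset hB hcat
  obtain ⟨c, hac, hcb⟩ := exists_between hab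
  obtain ⟨X, hX⟩ := IntervalFamily.exists_carrier_subset_Ioo hac
  obtain ⟨Y, hY⟩ := IntervalFamily.exists_carrier_subset_Ioo hcb
  obtain ⟨I, ℓ, hI, hℓ_pos, hℓ, hBI⟩ := exists_frequently_mem_of_volume_eq_zero hB₀
  obtain ⟨S, T, J, K, rfl, rfl, hSU, hTU, hJK, hJ, hK⟩ :=
    CantorScheme.exists_interleaved hℓ_pos hℓ hU hd X Y
  have hS := (S.limitSet_subset_carrier 0).trans hX
  have hT := (T.limitSet_subset_carrier 0).trans hY
  have hnull {R : CantorScheme} {P : Set ℕ} (hP : ∑' k : P, (R.gauge (ℓ k) : ℝ≥0∞) ≠ ∞) :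
      gaugeHausdorff R.gauge {x | ∃ᶠ k in cofinite, k ∈ P ∧ x ∈ I k} = 0 := by
    have hnull' := gaugeHausdorff_frequently_eq_zero R.isGauge_gauge.mono
      (fun k : P => hI k) (ne_top_of_le_ne_top hℓ (ENNReal.tsum_comp_le_tsum_of_injective
        Subtype.val_injective _)) hP
    simpa [← Subtype.val_injective.comap_cofinite_eq, frequently_comap] using hnull'
  have hcover : B ⊆ {x | ∃ᶠ k in cofinite, k ∈ J ∧ x ∈ I k} ∪
      {x | ∃ᶠ k in cofinite, k ∈ K ∧ x ∈ I k} := by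
    intro x hx
    rw [mem_union, mem_ofPred, mem_ofPred, ← frequently_or_distrib, Nat.cofinite_eq_atTop]
    refine ((hBI x hx).and_eventually hJK).mono fun k hk => ?_
    exact hk.2.imp (⟨·, hk.1⟩) (⟨·, hk.1⟩)
  have hdisj : Disjoint S.limitSet T.limitSet :=
    Set.disjoint_left.2 fun x hx hx' => (hS hx).2.not_gt (hT hx').1
  have hSB : S.limitSet ⊆ B := fun x hx => hUB ⟨hSU hx, (hS hx).1, (hS hx).2.trans hcb⟩
  have hTB : T.limitSet ⊆ B := fun x hx => hUB ⟨hTU hx, hac.trans (hT hx).1, (hT hx).2⟩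
  obtain ⟨C, hC, hSC, hTC, hCS, hBT⟩ := exists_measurableSet_diff_null
    S.isCompact_limitSet.measurableSet T.isCompact_limitSet.measurableSet hdisj
    (hnull hJ) (hnull hK) hcover
  exact ⟨C, hC,
    S.measuredByHausdorff_of_diff_null (subset_inter hSB hSC)
      (measure_mono_null (sdiff_subset_sdiff_left inter_subset_right) hCS),
    T.measuredByHausdorff_of_diff_null (subset_sdiff.2 ⟨hTB, hTC.symm⟩) hBT⟩

theorem corollary2p5_general {B : Set ℝ} (hB : BaireMeasurableSet B) (hcat : ¬ IsMeagre B) :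
    ∃ C, MeasurableSet C ∧ MeasuredByHausdorff (B ∩ C) ∧ MeasuredByHausdorff (B \ C) := by
  by_cases hB₀ : volume B = 0
  · exact exists_measuredByHausdorff_of_volume_eq_zero hB hcat hB₀
  · exact exists_measuredByHausdorff_of_volume_ne_zero hB₀

theorem corollary2p5 (B : Set ℝ) (hB : MeasurableSet B) (hcat : ¬ IsMeagre B) :
    ∃ B₁ B₂ : Set ℝ, MeasurableSet B₁ ∧ MeasurableSet B₂ ∧ Disjoint B₁ B₂ ∧ B = B₁ ∪ B₂ ∧
      MeasuredByHausdorff B₁ ∧ MeasuredByHausdorff B₂ := by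
  obtain ⟨C, hC, hBC⟩ := corollary2p5_general hB.baireMeasurableSet hcat
  exact ⟨B ∩ C, B \ C, hB.inter hC, hB.diff hC, disjoint_sdiff_inter.symm,
    (inter_union_sdiff B C).symm, hBC⟩
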